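/- Let $n\ge 1$, let $q$ be a measurable function on $\mathbb R^n$ with $0<p\le q(x)\le\overline q<\infty$, where $\underline q=\operatorname{ess\,inf} q$ and $\overline q=\operatorname{ess\,sup} q$, and let $v,w$ be weights on $\mathbb R^n$, i.e. measurable, non-negative, almost everywhere positive functions. Write $B(0,r)=\{y:|y|<r\}$ and, for measurable $\Omega\subset\mathbb R^n$, $$\|f\|_{L_{q(\cdot),w}(\Omega)}=\inf\Big\{\lambda>0:\int_\Omega\Big|\frac{f(x)w(x)}{\lambda}\Big|^{q(x)}dx\le1\Big\}\in[0,\infty],\qquad \inf\emptyset=\infty,$$ with $L_{q(\cdot)}=L_{q(\cdot),1}$. For measurable $f$ with $f>0$ almost everywhere let $$Gf(x)=\exp\Big(\frac1{|B(0,|x|)|}\int_{B(0,|x|)}\ln f(y)\,dy\Big)\in[0,\infty],$$ where the integral is $\int(\ln f)^+-\int(\ln f)^-\in[-\infty,\infty]$ (with $\infty-\infty=-\infty$), $\exp(-\infty)=0$ and $\exp(\infty)=\infty$. For $s>1$ put $$D(s,p,q)=\sup_{t>0}|B(0,t)|^{\frac{s-1}p}\,\Big\|\frac{w(\cdot)}{|B(0,|\cdot|)|^{s/p}}\,G\Big(\frac1v\Big)(\cdot)\Big\|_{L_{q(\cdot)}(|x|>t)}\in[0,\infty].$$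 Then there is a finite constant $C>0$ such that $$\|Gf\|_{L_{q(\cdot),w}(\mathbb R^n)}\le C\,\|f\|_{L_{p,v}(\mathbb R^n)}\quad\text{for every measurable } f>0\qquad(*)$$ if and only if $D(s,p,q)<\infty$ for some $s>1$; if $p>1$, this holds if and only if $D(s,p,q)<\infty$ for some $s\in(1,p)$. Moreover, the best constant $C$ in $(*)$, i.e. the infimum of all finite $C>0$ for which $(*)$ holds ($\infty$ if there is none), satisfies $$\sup_{s>1}\frac{e^{s/p}}{\big(e^s+\frac1{s-1}\big)^{1/p}}\,D(s,p,q)\le C\le\Big(\frac p{\underline q}+\frac{\overline q-p}{\overline q}\Big)^{2/p}\inf_{s>1}e^{\frac{s-1}p}D(s,p,q).$$ -/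

import Mathlib

open MeasureTheory
open scoped ENNReal NNReal

noncomputable section

/-- A weight: a Lebesgue measurable, non-negative, almost everywhere positive function. -/
structure IsWeight {n : ℕ} (w : EuclideanSpace ℝ (Fin n) → ℝ) : Prop where
  aemeasurable : AEMeasurable w volume
  nonneg : ∀ x, 0 ≤ w x
  ae_pos : ∀ᵐ x ∂(volume : Measure (EuclideanSpace ℝ (Fin n))), 0 < w x

/-- The Luxemburg functional of `L_{q(·),w}(Ω)`, for a function given by its absolute value
`F = |f|` in `[0,∞]`; it is `∞` exactly when no admissible scaling constant exists, that is,
when the function does not belong to the space. -/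
def luxNorm {n : ℕ} (q w : EuclideanSpace ℝ (Fin n) → ℝ) (Ω : Set (EuclideanSpace ℝ (Fin n)))
    (F : EuclideanSpace ℝ (Fin n) → ℝ≥0∞) : ℝ≥0∞ :=
  sInf {c : ℝ≥0∞ | 0 < c ∧ c < ⊤ ∧
    ∫⁻ x in Ω, (F x * ENNReal.ofReal (w x) / c) ^ (q x) ≤ 1}

/-- The integral of `ln f` over `A` in `[-∞,∞]`, as the integral of the positive part minus the
integral of the negative part. (If both are infinite, the value is `-∞`.) -/
def logIntegral {n : ℕ} (f : EuclideanSpace ℝ (Fin n) → ℝ)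
    (A : Set (EuclideanSpace ℝ (Fin n))) : EReal :=
  ((∫⁻ y in A, ENNReal.ofReal (Real.log (f y)) : ℝ≥0∞) : EReal) -
    ((∫⁻ y in A, ENNReal.ofReal (-Real.log (f y)) : ℝ≥0∞) : EReal)

/-- The geometric mean operator
`Gf(x) = exp (|B(0,|x|)|⁻¹ ∫_{B(0,|x|)} ln f)`, with values in `[0,∞]`. -/
def geomMean {n : ℕ} (f : EuclideanSpace ℝ (Fin n) → ℝ) (x : EuclideanSpace ℝ (Fin n)) : ℝ≥0∞ :=
  EReal.exp (logIntegral f (Metric.ball 0 ‖x‖) /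
    ((volume (Metric.ball (0 : EuclideanSpace ℝ (Fin n)) ‖x‖) : ℝ≥0∞) : EReal))

/-- The inequality `‖Gf‖_{L_{q(·),w}(ℝⁿ)} ≤ C ‖f‖_{L_{p,v}(ℝⁿ)}` for every measurable `f > 0`. -/
def GeomMeanInequality {n : ℕ} (p : ℝ) (q v w : EuclideanSpace ℝ (Fin n) → ℝ) (C : ℝ≥0∞) : Prop :=
  ∀ f : EuclideanSpace ℝ (Fin n) → ℝ, AEMeasurable f volume → (∀ x, 0 < f x) →
    luxNorm q w Set.univ (geomMean f) ≤ C * luxNorm (fun _ => p) v Set.univ (fun x => ‖f x‖ₑ)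

/-- The best constant: the infimum of all finite `C > 0` for which the inequality holds
(`∞` if there is none). -/
def bestConst {n : ℕ} (p : ℝ) (q v w : EuclideanSpace ℝ (Fin n) → ℝ) : ℝ≥0∞ :=
  sInf {C : ℝ≥0∞ | 0 < C ∧ C < ⊤ ∧ GeomMeanInequality p q v w C}

/-- `D(s,p,q) = sup_{t>0} |B(0,t)|^{(s-1)/p} ‖ w |B(0,|·|)|^{-s/p} G(1/v) ‖_{L_{q(·)}(|x|>t)}`. -/
def condD {n : ℕ} (s p : ℝ) (q v w : EuclideanSpace ℝ (Fin n) → ℝ) : ℝ≥0∞ :=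
  ⨆ (t : ℝ) (_ : 0 < t),
    volume (Metric.ball (0 : EuclideanSpace ℝ (Fin n)) t) ^ ((s - 1) / p) *
      luxNorm q (fun _ => 1) {x | t < ‖x‖}
        (fun x => ENNReal.ofReal (w x) /
          volume (Metric.ball (0 : EuclideanSpace ℝ (Fin n)) ‖x‖) ^ (s / p) *
            geomMean (fun y => 1 / v y) x)

end

/-! Write $V_x=|B(0,|x|)|$ and $W=wV^{-s/p}G(1/v)$. Everything rests on one computation: $V_y$ is
distributed uniformly on $(0,V_x)$ as $y$ runs over $B(0,|x|)$, so the mean of $\ln V_y$ there is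
$\ln V_x-1$.

Sufficiency. Split $Gf=G(fv)\,G(1/v)$ and apply Jensen to $p\ln(fv)+(s-1)\ln V_y$. This gives
$G(fv)(x)^p\le e^{s-1}V_x^{-s}\int_{B(0,|x|)}(fv)^pV_y^{s-1}dy$ (`geomMean_le_mul_rpow`). Once $f$
is normalised, $h=(fv)^p$ has mass at most one, and since $q(x)/p\ge1$ a second Jensen inequality
(`rpow_lintegral_mul_le`) moves the power $q(x)$ inside the integral against $h$. By Tonelli the
modular is then at most $\int h(y)\int_{|x|>|y|}(V_y^{(s-1)/p}W(x)/c)^{q(x)}dx\,dy$. For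
$c>D(s,p,q)$ the inner integral is at most one, by the condition at $t=|y|$. So $e^{(s-1)/p}D$
bounds the best constant for every real $s$; the exponent factor in the stated bound is at least one
and only weakens it.

Necessity. For each $t$ a two-piece radial profile divided by $v$ is tested. On $|x|>t$ its
geometric mean is exactly $|B(0,t)|^{(s-1)/p}V_x^{-s/p}G(1/v)$, while its norm is bounded
independently of $t$. This works for each $s>1$, hence in particular for $s\in(1,p)$. -/

/-- The volume of the ball of radius `r` about the origin, as a real number. -/
noncomputable def ballVol (n : ℕ) (r : ℝ) : ℝ :=
  (volume (Metric.ball (0 : EuclideanSpace ℝ (Fin n)) r)).toReal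

/-! ### Ball volume as a radial variable -/

section BallVolume

variable {n : ℕ}

theorem ofReal_ballVol (r : ℝ) :
    ENNReal.ofReal (ballVol n r) = volume (Metric.ball (0 : EuclideanSpace ℝ (Fin n)) r) :=
  ENNReal.ofReal_toReal measure_ball_lt_top.ne

theorem ballVol_nonneg (r : ℝ) : 0 ≤ ballVol n r := ENNReal.toReal_nonneg

theorem ballVol_pos {r : ℝ} (hr : 0 < r) : 0 < ballVol n r :=
  ENNReal.toReal_pos (Metric.measure_ball_pos _ _ hr).ne' measure_ball_lt_top.ne

theorem ballVol_eq (hn : 0 < n) {r : ℝ} (hr : 0 ≤ r) : ballVol n r = r ^ n * ballVol n 1 := by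
  have : Nonempty (Fin n) := ⟨⟨0, hn⟩⟩
  rw [ballVol, Measure.addHaar_ball _ _ hr, ENNReal.toReal_mul,
    ENNReal.toReal_ofReal (by positivity), finrank_euclideanSpace, Fintype.card_fin, ballVol]

theorem ballVol_lt_ballVol (hn : 0 < n) {r t : ℝ} (hr : 0 ≤ r) (h : r < t) :
    ballVol n r < ballVol n t := by
  rw [ballVol_eq hn hr, ballVol_eq hn (hr.trans h.le)]
  exact mul_lt_mul_of_pos_right (pow_lt_pow_left₀ h hr hn.ne') (ballVol_pos one_pos)

theorem ballVol_lt_ballVol_iff (hn : 0 < n) {r t : ℝ} (hr : 0 ≤ r) (ht : 0 ≤ t) :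
    ballVol n r < ballVol n t ↔ r < t := by
  refine ⟨fun h => ?_, ballVol_lt_ballVol hn hr⟩
  by_contra! h'
  rcases h'.eq_or_lt with rfl | h'
  · exact lt_irrefl _ h
  · exact lt_asymm h (ballVol_lt_ballVol hn ht h')

theorem exists_ballVol_eq (hn : 0 < n) {b : ℝ} (hb : 0 ≤ b) : ∃ r, 0 ≤ r ∧ ballVol n r = b := by
  have h1 : 0 < ballVol n 1 := ballVol_pos one_pos
  refine ⟨(b / ballVol n 1) ^ ((n : ℝ)⁻¹), by positivity, ?_⟩
  rw [ballVol_eq hn (by positivity), Real.rpow_inv_natCast_pow (by positivity) hn.ne',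
    div_mul_cancel₀ _ h1.ne']

theorem measurable_ballVol_norm :
    Measurable fun y : EuclideanSpace ℝ (Fin n) => ballVol n ‖y‖ := by
  have : Monotone (ballVol n) := fun a b h =>
    ENNReal.toReal_mono measure_ball_lt_top.ne (measure_mono (Metric.ball_subset_ball h))
  exact this.measurable.comp measurable_norm

/-- The distribution of `|B(0,|y|)|` under Lebesgue measure is Lebesgue measure on `(0,∞)`. -/
theorem map_ballVol_norm (hn : 0 < n) :
    (volume : Measure (EuclideanSpace ℝ (Fin n))).map (fun y => ballVol n ‖y‖) =
      volume.restrict (Set.Ioi 0) := by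
  -- Sublevel sets of the ball volume are themselves balls: the one below level $b>0$ is the centred
  -- ball of volume $b$. Half-lines then determine the measure through differences.
  have h1 : ∀ b : ℝ, (volume : Measure (EuclideanSpace ℝ (Fin n))).map
      (fun y => ballVol n ‖y‖) (Set.Iio b) = ENNReal.ofReal b := by
    intro b
    rw [Measure.map_apply measurable_ballVol_norm measurableSet_Iio]
    rcases le_total b 0 with hb | hb
    · rw [ENNReal.ofReal_of_nonpos hb]
      convert! measure_empty (μ := (volume : Measure (EuclideanSpace ℝ (Fin n))))
      ext y
      simpa using hb.trans (ballVol_nonneg _)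
    · obtain ⟨r, hr, rfl⟩ := exists_ballVol_eq hn hb
      rw [ofReal_ballVol]
      congr 1
      ext y
      simp [ballVol_lt_ballVol_iff hn (norm_nonneg y) hr]
  have h2 : ∀ b : ℝ, (volume : Measure ℝ).restrict (Set.Ioi 0) (Set.Iio b) = ENNReal.ofReal b := by
    intro b
    rw [Measure.restrict_apply measurableSet_Iio, Set.Iio_inter_Ioi, Real.volume_Ioo, sub_zero]
  refine (Measure.ext_of_Ico _ _ fun a b hab => ?_).symm
  have hIco : Set.Ico a b = Set.Iio b \ Set.Iio a := by
    ext
    simp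
  rw [hIco, measure_sdiff (Set.Iio_subset_Iio hab.le)
      measurableSet_Iio.nullMeasurableSet (by simp [h2]),
    measure_sdiff (Set.Iio_subset_Iio hab.le) measurableSet_Iio.nullMeasurableSet (by simp [h1]),
    h1, h1, h2, h2]

theorem map_ballVol_norm_restrict_ball (hn : 0 < n) {r : ℝ} (hr : 0 ≤ r) :
    ((volume : Measure (EuclideanSpace ℝ (Fin n))).restrict (Metric.ball 0 r)).map
      (fun y => ballVol n ‖y‖) = volume.restrict (Set.Ioo 0 (ballVol n r)) := by
  have : Metric.ball (0 : EuclideanSpace ℝ (Fin n)) r =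
      (fun y => ballVol n ‖y‖) ⁻¹' Set.Iio (ballVol n r) := by
    ext y
    simp [ballVol_lt_ballVol_iff hn (norm_nonneg y) hr]
  rw [this, ← Measure.restrict_map measurable_ballVol_norm measurableSet_Iio, map_ballVol_norm hn,
    Measure.restrict_restrict measurableSet_Iio, Set.Iio_inter_Ioi]

theorem integrableOn_ball_comp_ballVol (hn : 0 < n) {r : ℝ} (hr : 0 ≤ r) {φ : ℝ → ℝ}
    (hφ : IntegrableOn φ (Set.Ioo 0 (ballVol n r))) :
    IntegrableOn (fun y : EuclideanSpace ℝ (Fin n) => φ (ballVol n ‖y‖)) (Metric.ball 0 r) := by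
  rw [IntegrableOn, ← map_ballVol_norm_restrict_ball hn hr] at hφ
  exact hφ.comp_measurable measurable_ballVol_norm

theorem setIntegral_ball_comp_ballVol (hn : 0 < n) {r : ℝ} (hr : 0 ≤ r) {φ : ℝ → ℝ}
    (hφ : IntegrableOn φ (Set.Ioo 0 (ballVol n r))) :
    ∫ y in Metric.ball (0 : EuclideanSpace ℝ (Fin n)) r, φ (ballVol n ‖y‖) =
      ∫ u in 0..ballVol n r, φ u := by
  rw [intervalIntegral.integral_of_le (ballVol_nonneg _), integral_Ioc_eq_integral_Ioo,
    ← map_ballVol_norm_restrict_ball hn hr, integral_map measurable_ballVol_norm.aemeasurable]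
  rw [map_ballVol_norm_restrict_ball hn hr]
  exact hφ.aestronglyMeasurable

theorem integrableOn_ball_log_ballVol (hn : 0 < n) {r : ℝ} (hr : 0 ≤ r) :
    IntegrableOn (fun y : EuclideanSpace ℝ (Fin n) => Real.log (ballVol n ‖y‖))
      (Metric.ball 0 r) := by
  refine integrableOn_ball_comp_ballVol hn hr ?_
  have : IntervalIntegrable Real.log volume 0 (ballVol n r) :=
    intervalIntegral.intervalIntegrable_log'
  exact (intervalIntegrable_iff_integrableOn_Ioo_of_le (ballVol_nonneg _)).1 this

/-- Dividing by the volume gives the mean $\ln V-1$; the $-1$ is the source of the constant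
$e^{(s-1)/p}$. -/
theorem setIntegral_ball_log_ballVol (hn : 0 < n) {r : ℝ} (hr : 0 ≤ r) :
    ∫ y in Metric.ball (0 : EuclideanSpace ℝ (Fin n)) r, Real.log (ballVol n ‖y‖) =
      ballVol n r * Real.log (ballVol n r) - ballVol n r := by
  have : IntervalIntegrable Real.log volume 0 (ballVol n r) :=
    intervalIntegral.intervalIntegrable_log'
  rw [setIntegral_ball_comp_ballVol hn hr
    ((intervalIntegrable_iff_integrableOn_Ioo_of_le (ballVol_nonneg _)).1 this),
    integral_log_from_zero]

end BallVolume

/-! ### The geometric mean: infinite cases, products, Jensen -/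

section GeomMean

variable {n : ℕ}

/-- The negative part is tested first because $\infty-\infty$ counts as $-\infty$. The centre is
excluded, since its ball has volume zero. -/
theorem geomMean_eq_ite (f : EuclideanSpace ℝ (Fin n) → ℝ) {x : EuclideanSpace ℝ (Fin n)}
    (hx : x ≠ 0) :
    geomMean f x =
      if ∫⁻ y in Metric.ball 0 ‖x‖, ENNReal.ofReal (-Real.log (f y)) = ⊤ then 0
      else if ∫⁻ y in Metric.ball 0 ‖x‖, ENNReal.ofReal (Real.log (f y)) = ⊤ then ⊤
      else ENNReal.ofReal (Real.exp
        (((∫⁻ y in Metric.ball 0 ‖x‖, ENNReal.ofReal (Real.log (f y))).toReal -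
          (∫⁻ y in Metric.ball 0 ‖x‖, ENNReal.ofReal (-Real.log (f y))).toReal) /
            ballVol n ‖x‖)) := by
  have hV : 0 < ballVol n ‖x‖ := ballVol_pos (norm_pos_iff.2 hx)
  have hV' : ((volume (Metric.ball (0 : EuclideanSpace ℝ (Fin n)) ‖x‖) : ℝ≥0∞) : EReal) =
      (ballVol n ‖x‖ : ℝ) := by
    rw [← ofReal_ballVol, EReal.coe_ennreal_ofReal, max_eq_left hV.le]
  have hV0 : (0 : EReal) < (ballVol n ‖x‖ : ℝ) := by exact_mod_cast hV
  rw [geomMean, logIntegral, hV']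
  generalize ∫⁻ y in Metric.ball 0 ‖x‖, ENNReal.ofReal (-Real.log (f y)) = N
  generalize ∫⁻ y in Metric.ball 0 ‖x‖, ENNReal.ofReal (Real.log (f y)) = P
  split_ifs with hN hP
  · rw [hN, EReal.coe_ennreal_top, EReal.sub_top,
      EReal.bot_div_of_pos_ne_top hV0 (EReal.coe_ne_top _), EReal.exp_bot]
  · lift N to ℝ≥0 using hN
    rw [hP, EReal.coe_ennreal_top]
    change EReal.exp ((⊤ - ((N : ℝ) : EReal)) / _) = _
    rw [EReal.top_sub_coe, EReal.top_div_of_pos_ne_top hV0 (EReal.coe_ne_top _), EReal.exp_top]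
  · lift N to ℝ≥0 using hN
    lift P to ℝ≥0 using hP
    change EReal.exp ((((P : ℝ) : EReal) - ((N : ℝ) : EReal)) / _) = _
    rw [← EReal.coe_sub, ← EReal.coe_div, EReal.exp_coe]
    rfl

theorem measurable_setLIntegral_ball_norm (φ : EuclideanSpace ℝ (Fin n) → ℝ≥0∞) :
    Measurable fun x : EuclideanSpace ℝ (Fin n) => ∫⁻ y in Metric.ball 0 ‖x‖, φ y := by
  have : Monotone fun r : ℝ => ∫⁻ y in Metric.ball (0 : EuclideanSpace ℝ (Fin n)) r, φ y :=
    fun a b h => lintegral_mono_set (Metric.ball_subset_ball h)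
  exact this.measurable.comp measurable_norm

theorem ae_ne_zero_of_pos (hn : 0 < n) :
    ∀ᵐ x ∂(volume : Measure (EuclideanSpace ℝ (Fin n))), x ≠ 0 := by
  have : Nonempty (Fin n) := ⟨⟨0, hn⟩⟩
  exact Measure.ae_ne volume 0

theorem aemeasurable_geomMean (hn : 0 < n) (f : EuclideanSpace ℝ (Fin n) → ℝ) :
    AEMeasurable (geomMean f) volume := by
  have hN := measurable_setLIntegral_ball_norm (n := n) fun y => ENNReal.ofReal (-Real.log (f y))
  have hP := measurable_setLIntegral_ball_norm (n := n) fun y => ENNReal.ofReal (Real.log (f y))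
  refine ⟨_, ?_, (ae_ne_zero_of_pos hn).mono fun x hx => geomMean_eq_ite f hx⟩
  refine Measurable.ite (hN (measurableSet_singleton ⊤)) measurable_const ?_
  refine Measurable.ite (hP (measurableSet_singleton ⊤)) measurable_const ?_
  exact ENNReal.measurable_ofReal.comp (Real.measurable_exp.comp
    ((hP.ennreal_toReal.sub hN.ennreal_toReal).div measurable_ballVol_norm))

theorem integrable_of_lintegral_ofReal_ne_top {α : Type*} [MeasurableSpace α] {μ : Measure α}
    {g : α → ℝ} (hg : AEStronglyMeasurable g μ) (hP : ∫⁻ y, ENNReal.ofReal (g y) ∂μ ≠ ⊤)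
    (hN : ∫⁻ y, ENNReal.ofReal (-g y) ∂μ ≠ ⊤) : Integrable g μ := by
  refine ⟨hg, lt_of_le_of_lt ?_ (ENNReal.add_lt_top.2 ⟨hP.lt_top, hN.lt_top⟩)⟩
  rw [← lintegral_add_left' hg.aemeasurable.ennreal_ofReal]
  refine lintegral_mono fun y => ?_
  rw [← ofReal_norm, Real.norm_eq_abs]
  rcases le_total 0 (g y) with h | h
  · rw [abs_of_nonneg h]
    exact le_self_add
  · rw [abs_of_nonpos h]
    exact le_add_self

/-- Serves to pass finiteness of positive and negative parts between the terms of a sum of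
logarithms when the whole sum need not be integrable. -/
theorem lintegral_ofReal_ne_top_of_le_add {α : Type*} [MeasurableSpace α] {μ : Measure α}
    {a b c : α → ℝ} (hc : AEMeasurable c μ) (h : ∀ᵐ y ∂μ, a y ≤ b y + c y)
    (hB : ∫⁻ y, ENNReal.ofReal (b y) ∂μ ≠ ⊤) (hC : ∫⁻ y, ENNReal.ofReal (c y) ∂μ ≠ ⊤) :
    ∫⁻ y, ENNReal.ofReal (a y) ∂μ ≠ ⊤ := by
  refine (lt_of_le_of_lt ?_ (ENNReal.add_lt_top.2 ⟨hB.lt_top, hC.lt_top⟩)).ne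
  rw [← lintegral_add_right' _ hc.ennreal_ofReal]
  refine lintegral_mono_ae (h.mono fun y hy => ?_)
  exact (ENNReal.ofReal_le_ofReal hy).trans ENNReal.ofReal_add_le

theorem geomMean_eq_exp {f : EuclideanSpace ℝ (Fin n) → ℝ} {x : EuclideanSpace ℝ (Fin n)}
    (hx : x ≠ 0) (hf : IntegrableOn (fun y => Real.log (f y)) (Metric.ball 0 ‖x‖)) :
    geomMean f x = ENNReal.ofReal (Real.exp
      ((∫ y in Metric.ball 0 ‖x‖, Real.log (f y)) / ballVol n ‖x‖)) := by
  have hP : ∫⁻ y in Metric.ball 0 ‖x‖, ENNReal.ofReal (Real.log (f y)) ≠ ⊤ :=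
    hf.lintegral_lt_top.ne
  have hN : ∫⁻ y in Metric.ball 0 ‖x‖, ENNReal.ofReal (-Real.log (f y)) ≠ ⊤ :=
    hf.neg.lintegral_lt_top.ne
  rw [geomMean_eq_ite f hx, if_neg hN, if_neg hP,
    integral_eq_lintegral_pos_part_sub_lintegral_neg_part hf]

/-- Multiplicativity of the geometric mean when one factor has an integrable logarithm. -/
theorem geomMean_eq_mul {f g u : EuclideanSpace ℝ (Fin n) → ℝ} {x : EuclideanSpace ℝ (Fin n)}
    (hx : x ≠ 0) (hg : IntegrableOn (fun y => Real.log (g y)) (Metric.ball 0 ‖x‖))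
    (hu : AEMeasurable u volume)
    (h : ∀ᵐ y ∂(volume : Measure (EuclideanSpace ℝ (Fin n))),
      Real.log (f y) = Real.log (g y) + Real.log (u y)) :
    geomMean f x = ENNReal.ofReal (Real.exp
      ((∫ y in Metric.ball 0 ‖x‖, Real.log (g y)) / ballVol n ‖x‖)) * geomMean u x := by
  have hball := ae_restrict_of_ae (s := Metric.ball 0 ‖x‖) h
  have hgm := hg.aemeasurable
  have hPg := hg.lintegral_lt_top.ne
  have hNg : ∫⁻ y in Metric.ball 0 ‖x‖, ENNReal.ofReal (-Real.log (g y)) ≠ ⊤ :=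
    hg.neg.lintegral_lt_top.ne
  -- Adding the integrable function $\ln g$ makes neither part of $\ln u$ change between finite and
  -- infinite, so $f$ and $u$ fall in the same branch of `geomMean_eq_ite`.
  have hN : ∫⁻ y in Metric.ball 0 ‖x‖, ENNReal.ofReal (-Real.log (f y)) = ⊤ ↔
      ∫⁻ y in Metric.ball 0 ‖x‖, ENNReal.ofReal (-Real.log (u y)) = ⊤ := by
    rw [← not_iff_not]
    exact ⟨fun H => lintegral_ofReal_ne_top_of_le_add hgm
        (hball.mono fun y hy => by linarith) H hPg,
      fun H => lintegral_ofReal_ne_top_of_le_add hgm.neg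
        (hball.mono fun y hy => by simp only [Pi.neg_apply]; linarith) H hNg⟩
  have hP : ∫⁻ y in Metric.ball 0 ‖x‖, ENNReal.ofReal (Real.log (f y)) = ⊤ ↔
      ∫⁻ y in Metric.ball 0 ‖x‖, ENNReal.ofReal (Real.log (u y)) = ⊤ := by
    rw [← not_iff_not]
    exact ⟨fun H => lintegral_ofReal_ne_top_of_le_add hgm.neg
        (hball.mono fun y hy => by simp only [Pi.neg_apply]; linarith) H hNg,
      fun H => lintegral_ofReal_ne_top_of_le_add hgm
        (hball.mono fun y hy => by linarith) H hPg⟩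
  by_cases hNu : ∫⁻ y in Metric.ball 0 ‖x‖, ENNReal.ofReal (-Real.log (u y)) = ⊤
  · rw [geomMean_eq_ite f hx, geomMean_eq_ite u hx, if_pos hNu, if_pos (hN.2 hNu), mul_zero]
  by_cases hPu : ∫⁻ y in Metric.ball 0 ‖x‖, ENNReal.ofReal (Real.log (u y)) = ⊤
  · rw [geomMean_eq_ite f hx, geomMean_eq_ite u hx, if_neg hNu, if_neg (mt hN.1 hNu), if_pos hPu,
      if_pos (hP.2 hPu), ENNReal.mul_top (ENNReal.ofReal_pos.2 (Real.exp_pos _)).ne']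
  have hui : IntegrableOn (fun y => Real.log (u y)) (Metric.ball 0 ‖x‖) :=
    integrable_of_lintegral_ofReal_ne_top
      (Real.measurable_log.comp_aemeasurable hu.restrict).aestronglyMeasurable hPu hNu
  have hfi : IntegrableOn (fun y => Real.log (f y)) (Metric.ball 0 ‖x‖) :=
    (hg.add hui).congr (hball.mono fun y hy => hy.symm)
  rw [geomMean_eq_exp hx hfi, geomMean_eq_exp hx hui, ← ENNReal.ofReal_mul (Real.exp_nonneg _),
    ← Real.exp_add, ← add_div, ← integral_add hg hui, integral_congr_ae hball]

/-- The Jensen inequality for the exponential: a geometric mean is at most the arithmetic mean. -/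
theorem exp_average_log_mul_measure_le {α : Type*} [MeasurableSpace α] {μ : Measure α} {A : Set α}
    (h0 : μ A ≠ 0) (hA : μ A ≠ ⊤) {L : α → ℝ} (hL : IntegrableOn L A μ) :
    ENNReal.ofReal (Real.exp ((∫ y in A, L y ∂μ) / μ.real A)) * μ A ≤
      ∫⁻ y in A, ENNReal.ofReal (Real.exp (L y)) ∂μ := by
  by_cases htop : ∫⁻ y in A, ENNReal.ofReal (Real.exp (L y)) ∂μ = ⊤
  · rw [htop]
    exact le_top
  have hm : AEStronglyMeasurable (fun y => Real.exp (L y)) (μ.restrict A) :=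
    Real.continuous_exp.comp_aestronglyMeasurable hL.aestronglyMeasurable
  have hi : IntegrableOn (fun y => Real.exp (L y)) A μ :=
    (lintegral_ofReal_ne_top_iff_integrable hm (ae_of_all _ fun y => Real.exp_nonneg _)).1 htop
  have hμ : 0 < μ.real A := ENNReal.toReal_pos h0 hA
  have := convexOn_exp.map_set_average_le Real.continuous_exp.continuousOn isClosed_univ h0 hA
    (ae_of_all _ fun _ => Set.mem_univ _) hL hi
  rw [setAverage_eq, setAverage_eq, smul_eq_mul, smul_eq_mul, inv_mul_eq_div,
    inv_mul_eq_div, le_div_iff₀ hμ] at this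
  rw [← ofReal_integral_eq_lintegral_ofReal hi (ae_of_all _ fun y => Real.exp_nonneg _),
    ← ENNReal.ofReal_toReal hA, ← ENNReal.ofReal_mul (Real.exp_nonneg _)]
  exact ENNReal.ofReal_le_ofReal this

end GeomMean

/-! ### Two Jensen inequalities -/

section UpperBound

variable {n : ℕ}

/-- Weighted Jensen bound for the geometric mean of a product, one factor of which is
`p`-integrable. -/
theorem geomMean_le_mul_rpow (hn : 0 < n) {p s : ℝ} (hp : 0 < p)
    {f g u : EuclideanSpace ℝ (Fin n) → ℝ} {x : EuclideanSpace ℝ (Fin n)} (hx : x ≠ 0)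
    (hf : AEMeasurable f volume) (hg : AEMeasurable g volume) (hu : AEMeasurable u volume)
    (hgpos : ∀ᵐ y ∂(volume : Measure (EuclideanSpace ℝ (Fin n))), 0 < g y)
    (h : ∀ᵐ y ∂(volume : Measure (EuclideanSpace ℝ (Fin n))),
      Real.log (f y) = Real.log (g y) + Real.log (u y))
    (hgp : ∫⁻ y in Metric.ball 0 ‖x‖, ENNReal.ofReal (g y ^ p) ≠ ⊤)
    (hG : geomMean u x ≠ ⊤) :
    geomMean f x ≤ geomMean u x *
      (ENNReal.ofReal (Real.exp (s - 1)) /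
        volume (Metric.ball (0 : EuclideanSpace ℝ (Fin n)) ‖x‖) ^ s *
        ∫⁻ y in Metric.ball 0 ‖x‖, ENNReal.ofReal (g y ^ p) *
          volume (Metric.ball (0 : EuclideanSpace ℝ (Fin n)) ‖y‖) ^ (s - 1)) ^ (1 / p) := by
  have h' := ae_restrict_of_ae (s := Metric.ball 0 ‖x‖) h
  have hlog {k : EuclideanSpace ℝ (Fin n) → ℝ} (hk : AEMeasurable k volume) :
      AEMeasurable (fun y => Real.log (k y)) (volume.restrict (Metric.ball 0 ‖x‖)) :=
    Real.measurable_log.comp_aemeasurable hk.restrict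
  -- If the negative part of $\ln f$ diverges, then $Gf(x)=0$. Otherwise all three logarithms turn
  -- out to be integrable on the ball.
  by_cases hNf : ∫⁻ y in Metric.ball 0 ‖x‖, ENNReal.ofReal (-Real.log (f y)) = ⊤
  · rw [geomMean_eq_ite f hx, if_pos hNf]
    exact zero_le
  -- Uses $\ln g\le g^p/p$.
  have hPg : ∫⁻ y in Metric.ball 0 ‖x‖, ENNReal.ofReal (Real.log (g y)) ≠ ⊤ := by
    have hfin := (ENNReal.mul_lt_top (ENNReal.ofReal_lt_top (r := p⁻¹)) hgp.lt_top).ne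
    rw [← lintegral_const_mul' _ _ ENNReal.ofReal_ne_top] at hfin
    refine ne_top_of_le_ne_top hfin (lintegral_mono_ae (ae_restrict_of_ae ?_))
    filter_upwards [hgpos] with y hy
    rw [← ENNReal.ofReal_mul (by positivity), inv_mul_eq_div]
    exact ENNReal.ofReal_le_ofReal (Real.log_le_rpow_div hy.le hp)
  have hNu : ∫⁻ y in Metric.ball 0 ‖x‖, ENNReal.ofReal (-Real.log (u y)) ≠ ⊤ :=
    lintegral_ofReal_ne_top_of_le_add (hlog hg) (h'.mono fun y hy => by linarith) hNf hPg
  have hPu : ∫⁻ y in Metric.ball 0 ‖x‖, ENNReal.ofReal (Real.log (u y)) ≠ ⊤ := by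
    intro hPu
    rw [geomMean_eq_ite u hx, if_neg hNu, if_pos hPu] at hG
    exact hG rfl
  have hPf : ∫⁻ y in Metric.ball 0 ‖x‖, ENNReal.ofReal (Real.log (f y)) ≠ ⊤ :=
    lintegral_ofReal_ne_top_of_le_add (hlog hu) (h'.mono fun y hy => hy.le) hPg hPu
  have hui := integrable_of_lintegral_ofReal_ne_top (hlog hu).aestronglyMeasurable hPu hNu
  have hfi := integrable_of_lintegral_ofReal_ne_top (hlog hf).aestronglyMeasurable hPf hNf
  have hgi : IntegrableOn (fun y => Real.log (g y)) (Metric.ball 0 ‖x‖) :=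
    (hfi.sub hui).congr (h'.mono fun y hy => by simp only [Pi.sub_apply]; linarith)
  rw [geomMean_eq_mul hx hgi hu h, mul_comm]
  gcongr
  rw [one_div, ENNReal.le_rpow_inv_iff hp, ENNReal.ofReal_rpow_of_pos (Real.exp_pos _),
    ← Real.exp_mul]
  have hV : 0 < ballVol n ‖x‖ := ballVol_pos (norm_pos_iff.2 hx)
  have hlV := integrableOn_ball_log_ballVol hn (norm_nonneg x)
  -- The exponential of this $L$ is the integrand $g^pV_y^{s-1}$ of the Hardy average.
  have hJ := exp_average_log_mul_measure_le (μ := volume)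
    (A := Metric.ball (0 : EuclideanSpace ℝ (Fin n)) ‖x‖)
    (L := fun y => p * Real.log (g y) + (s - 1) * Real.log (ballVol n ‖y‖))
    (Metric.measure_ball_pos _ _ (norm_pos_iff.2 hx)).ne' measure_ball_lt_top.ne
    ((hgi.const_mul p).add (hlV.const_mul (s - 1)))
  have hR : ∫⁻ y in Metric.ball (0 : EuclideanSpace ℝ (Fin n)) ‖x‖, ENNReal.ofReal (Real.exp
        (p * Real.log (g y) + (s - 1) * Real.log (ballVol n ‖y‖))) =
      ∫⁻ y in Metric.ball 0 ‖x‖, ENNReal.ofReal (g y ^ p) *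
          volume (Metric.ball (0 : EuclideanSpace ℝ (Fin n)) ‖y‖) ^ (s - 1) := by
    refine lintegral_congr_ae (ae_restrict_of_ae ?_)
    filter_upwards [hgpos, ae_ne_zero_of_pos hn] with y hy hy0
    have hVy : 0 < ballVol n ‖y‖ := ballVol_pos (norm_pos_iff.2 hy0)
    rw [← ofReal_ballVol, ENNReal.ofReal_rpow_of_pos hVy, ← ENNReal.ofReal_mul (by positivity),
      Real.rpow_def_of_pos hy, Real.rpow_def_of_pos hVy, ← Real.exp_add]
    ring_nf
  have hI : ∫ y in Metric.ball (0 : EuclideanSpace ℝ (Fin n)) ‖x‖,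
        (p * Real.log (g y) + (s - 1) * Real.log (ballVol n ‖y‖)) =
      p * (∫ y in Metric.ball 0 ‖x‖, Real.log (g y)) +
        (s - 1) * (ballVol n ‖x‖ * Real.log (ballVol n ‖x‖) - ballVol n ‖x‖) := by
    rw [integral_add (hgi.const_mul p) (hlV.const_mul (s - 1)), integral_const_mul,
      integral_const_mul, setIntegral_ball_log_ballVol hn (norm_nonneg x)]
  rw [hR, hI, ← ofReal_ballVol] at hJ
  refine le_trans (le_of_eq ?_) (mul_le_mul_right hJ _)
  rw [← ofReal_ballVol, ENNReal.ofReal_rpow_of_pos hV,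
    ← ENNReal.ofReal_div_of_pos (by positivity), ← ENNReal.ofReal_mul (by positivity),
    ← ENNReal.ofReal_mul (by positivity)]
  congr 1
  change _ = _ * (Real.exp (_ / ballVol n ‖x‖) * _)
  have hVexp : ballVol n ‖x‖ = Real.exp (Real.log (ballVol n ‖x‖)) := (Real.exp_log hV).symm
  rw [Real.rpow_def_of_pos hV, ← Real.exp_sub]
  -- Writing the bare volume factor as $e^{\ln V}$ turns both sides into single exponentials, whose
  -- exponents are then compared.
  nth_rewrite 7 [hVexp]
  rw [← Real.exp_add, ← Real.exp_add]
  congr 1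
  field_simp
  ring

/-- The Jensen inequality for powers, with respect to a density of mass at most one. -/
theorem rpow_lintegral_mul_le {α : Type*} [MeasurableSpace α] {μ : Measure α} {h φ : α → ℝ≥0∞}
    (hh : AEMeasurable h μ) (hφ : AEMeasurable φ μ) (hmass : ∫⁻ y, h y ∂μ ≤ 1) {r : ℝ}
    (hr : 1 ≤ r) : (∫⁻ y, h y * φ y ∂μ) ^ r ≤ ∫⁻ y, h y * φ y ^ r ∂μ := by
  rcases hr.eq_or_lt with rfl | hr
  · simp
  have hr0 : 0 < r := one_pos.trans hr
  have hc : r.HolderConjugate (r.conjExponent) := Real.HolderConjugate.conjExponent hr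
  have hc0 : 0 < r.conjExponent := hc.symm.pos
  have hsum : 1 / r + 1 / r.conjExponent = 1 := by
    simpa using hc.inv_add_inv_eq_one
  -- Hölder for $h\varphi=(h^{1/r}\varphi)\,h^{1/r'}$; the second factor contributes $(\int
  -- h)^{1/r'}\le1$.
  have key := ENNReal.lintegral_mul_le_Lp_mul_Lq μ hc
    ((hh.pow_const (1 / r)).mul hφ) (hh.pow_const (1 / r.conjExponent))
  have e1 : ∀ y, ((fun y => h y ^ (1 / r)) * φ) y ^ r = h y * φ y ^ r := fun y => by
    simp only [Pi.mul_apply]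
    rw [ENNReal.mul_rpow_of_nonneg _ _ hr0.le, ← ENNReal.rpow_mul, one_div_mul_cancel hr0.ne',
      ENNReal.rpow_one]
  have e2 : ∀ y, (h y ^ (1 / r.conjExponent)) ^ r.conjExponent = h y := fun y => by
    rw [← ENNReal.rpow_mul, one_div_mul_cancel hc0.ne', ENNReal.rpow_one]
  have e3 : ∀ y, (((fun y => h y ^ (1 / r)) * φ) * fun y => h y ^ (1 / r.conjExponent)) y =
      h y * φ y := fun y => by
    simp only [Pi.mul_apply]
    rw [mul_right_comm, ← ENNReal.rpow_add_of_nonneg _ _ (by positivity) (by positivity), hsum,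
      ENNReal.rpow_one]
  rw [lintegral_congr e1, lintegral_congr e2, lintegral_congr e3] at key
  rw [← ENNReal.le_rpow_inv_iff hr0, ← one_div]
  exact key.trans (mul_le_of_le_one_right' (ENNReal.rpow_le_one hmass (by positivity)))

end UpperBound

/-! ### Sufficiency: Hardy-type domination and Tonelli -/

section HardyBound

variable {n : ℕ} {p s : ℝ} {q v w : EuclideanSpace ℝ (Fin n) → ℝ} {c : ℝ≥0∞}

/-- The function whose norms outside balls enter `condD`. -/
noncomputable def hardyWeight (s p : ℝ) (v w : EuclideanSpace ℝ (Fin n) → ℝ)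
    (x : EuclideanSpace ℝ (Fin n)) : ℝ≥0∞ :=
  ENNReal.ofReal (w x) / volume (Metric.ball (0 : EuclideanSpace ℝ (Fin n)) ‖x‖) ^ (s / p) *
    geomMean (fun y => 1 / v y) x

theorem measurable_volume_ball_norm :
    Measurable fun x : EuclideanSpace ℝ (Fin n) =>
      volume (Metric.ball (0 : EuclideanSpace ℝ (Fin n)) ‖x‖) := by
  simpa only [setLIntegral_one] using measurable_setLIntegral_ball_norm (n := n) fun _ => 1

theorem aemeasurable_hardyWeight (hn : 0 < n) (hw : AEMeasurable w volume) :
    AEMeasurable (hardyWeight s p v w) volume :=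
  (hw.ennreal_ofReal.div (measurable_volume_ball_norm.pow_const _).aemeasurable).mul
    (aemeasurable_geomMean hn _)

/-- Strictness of `condD s p q v w < c` supplies an admissible constant below $c/k$, where
$k=|B(0,t)|^{(s-1)/p}$, so attainment of the Luxemburg infimum is not needed. -/
theorem setLIntegral_hardyWeight_le_one
    (hpos : ∀ᵐ x ∂(volume : Measure (EuclideanSpace ℝ (Fin n))), 0 < q x)
    (hc : condD s p q v w < c) {t : ℝ} (ht : 0 < t) :
    ∫⁻ x in {x : EuclideanSpace ℝ (Fin n) | t < ‖x‖},
      (volume (Metric.ball (0 : EuclideanSpace ℝ (Fin n)) t) ^ ((s - 1) / p) *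
        hardyWeight s p v w x / c) ^ q x ≤ 1 := by
  have hV0 : volume (Metric.ball (0 : EuclideanSpace ℝ (Fin n)) t) ≠ 0 :=
    (Metric.measure_ball_pos _ _ ht).ne'
  have hVt : volume (Metric.ball (0 : EuclideanSpace ℝ (Fin n)) t) ≠ ⊤ := measure_ball_lt_top.ne
  have hlt : volume (Metric.ball (0 : EuclideanSpace ℝ (Fin n)) t) ^ ((s - 1) / p) *
      luxNorm q (fun _ => 1) {x | t < ‖x‖} (hardyWeight s p v w) < c :=
    lt_of_le_of_lt (le_iSup₂ (f := fun (t : ℝ) (_ : 0 < t) =>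
      volume (Metric.ball (0 : EuclideanSpace ℝ (Fin n)) t) ^ ((s - 1) / p) *
      luxNorm q (fun _ => 1) {x | t < ‖x‖} (hardyWeight s p v w)) t ht) hc
  have hk0 := (ENNReal.rpow_pos (p := (s - 1) / p) (pos_iff_ne_zero.2 hV0) hVt).ne'
  have hkt := ENNReal.rpow_ne_top_of_ne_zero (y := (s - 1) / p) hV0 hVt
  revert hlt hk0 hkt
  generalize volume (Metric.ball (0 : EuclideanSpace ℝ (Fin n)) t) ^ ((s - 1) / p) = k
  intro hlt hk0 hkt
  have hlt' : luxNorm q (fun _ => 1) {x | t < ‖x‖} (hardyWeight s p v w) < c / k := by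
    rwa [ENNReal.lt_div_iff_mul_lt (Or.inl hk0) (Or.inl hkt), mul_comm]
  obtain ⟨c', ⟨-, -, hmod⟩, hcc'⟩ := sInf_lt_iff.1 hlt'
  refine le_trans (lintegral_mono_ae ?_) hmod
  filter_upwards [ae_restrict_of_ae hpos] with x hx
  refine ENNReal.rpow_le_rpow ?_ hx.le
  have : k / c ≤ c'⁻¹ := by
    rw [← ENNReal.inv_div (Or.inl hkt) (Or.inl hk0)]
    exact ENNReal.inv_le_inv.2 hcc'.le
  calc k * hardyWeight s p v w x / c = hardyWeight s p v w x * (k / c) := by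
        rw [div_eq_mul_inv, div_eq_mul_inv]; ring
    _ ≤ hardyWeight s p v w x * c'⁻¹ := by gcongr
    _ = hardyWeight s p v w x * ENNReal.ofReal 1 / c' := by
        rw [ENNReal.ofReal_one, mul_one, div_eq_mul_inv]

/-- A finite modular forces finiteness almost everywhere outside each ball of radius $1/(k+1)$, and
these exteriors exhaust the punctured space. It excludes $G(1/v)=\infty$, which the product formula
for $Gf$ could not handle. -/
theorem ae_hardyWeight_ne_top (hn : 0 < n) (hq : AEMeasurable q volume)
    (hw : AEMeasurable w volume)
    (hpos : ∀ᵐ x ∂(volume : Measure (EuclideanSpace ℝ (Fin n))), 0 < q x)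
    (hc : condD s p q v w < c) (hct : c < ⊤) :
    ∀ᵐ x ∂(volume : Measure (EuclideanSpace ℝ (Fin n))), hardyWeight s p v w x ≠ ⊤ := by
  have hm := aemeasurable_hardyWeight (s := s) (p := p) (v := v) hn hw
  have key : ∀ k : ℕ, ∀ᵐ x ∂(volume : Measure (EuclideanSpace ℝ (Fin n))),
      1 / ((k : ℝ) + 1) < ‖x‖ → hardyWeight s p v w x ≠ ⊤ := by
    intro k
    have ht : 0 < 1 / ((k : ℝ) + 1) := Nat.one_div_pos_of_nat
    have h1 := setLIntegral_hardyWeight_le_one hpos hc ht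
    have hV0 : 0 < volume (Metric.ball (0 : EuclideanSpace ℝ (Fin n)) (1 / ((k : ℝ) + 1))) :=
      Metric.measure_ball_pos _ _ ht
    have hk0 := (ENNReal.rpow_pos (p := (s - 1) / p) hV0 measure_ball_lt_top.ne).ne'
    have h2 := ae_lt_top' (((((hm.const_mul _).div_const c).pow hq).restrict))
      (h1.trans_lt ENNReal.one_lt_top).ne
    rw [ae_restrict_iff' (measurableSet_lt measurable_const measurable_norm)] at h2
    filter_upwards [h2, hpos] with x hx hqx hxt htop
    have := hx hxt
    rw [htop, ENNReal.mul_top hk0, ENNReal.top_div_of_ne_top hct.ne,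
      ENNReal.top_rpow_of_pos hqx] at this
    exact lt_irrefl _ this
  filter_upwards [ae_all_iff.2 key, ae_ne_zero_of_pos hn] with x hx hx0
  obtain ⟨k, hk⟩ := exists_nat_one_div_lt (norm_pos_iff.2 hx0)
  exact hx k hk

/-- Pointwise domination of the rescaled geometric mean by a Hardy-type average. -/
theorem geomMean_mul_div_le (hn : 0 < n) (hp : 0 < p) (hv : IsWeight v)
    {f : EuclideanSpace ℝ (Fin n) → ℝ} (hf : AEMeasurable f volume) (hfpos : ∀ x, 0 < f x)
    {l : ℝ≥0∞} (hl0 : 0 < l) (hlt : l < ⊤)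
    (hmass : ∫⁻ y, (‖f y‖ₑ * ENNReal.ofReal (v y) / l) ^ p ≤ 1)
    {x : EuclideanSpace ℝ (Fin n)} (hx : x ≠ 0) (hwx : 0 < w x)
    (hG : hardyWeight s p v w x ≠ ⊤) (hc0 : 0 < c) :
    geomMean f x * ENNReal.ofReal (w x) /
        (ENNReal.ofReal (Real.exp ((s - 1) / p)) * c * l) ≤
      (∫⁻ y, (‖f y‖ₑ * ENNReal.ofReal (v y) / l) ^ p *
        ((if ‖y‖ < ‖x‖ then volume (Metric.ball (0 : EuclideanSpace ℝ (Fin n)) ‖y‖) ^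
          ((s - 1) / p) * hardyWeight s p v w x / c else 0) ^ p)) ^ (1 / p) := by
  set V := volume (Metric.ball (0 : EuclideanSpace ℝ (Fin n)) ‖x‖) with hVdef
  have hV0 : V ≠ 0 := (Metric.measure_ball_pos _ _ (norm_pos_iff.2 hx)).ne'
  have hVt : V ≠ ⊤ := measure_ball_lt_top.ne
  -- Positivity of $w(x)$ matters here: otherwise $0\cdot\infty=0$ would hide an infinite
  -- $G(1/v)(x)$.
  have hGx : geomMean (fun y => 1 / v y) x ≠ ⊤ := by
    intro h
    refine hG ?_
    rw [hardyWeight, h, ENNReal.mul_top]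
    exact (ENNReal.div_pos (ENNReal.ofReal_pos.2 hwx).ne'
      (ENNReal.rpow_ne_top_of_ne_zero hV0 hVt)).ne'
  set h : EuclideanSpace ℝ (Fin n) → ℝ≥0∞ := fun y => (‖f y‖ₑ * ENNReal.ofReal (v y) / l) ^ p
    with hh
  have hgh : ∀ y, ENNReal.ofReal ((f y * v y) ^ p) = l ^ p * h y := by
    intro y
    simp only [hh]
    rw [← ENNReal.mul_rpow_of_nonneg _ _ hp.le, ENNReal.mul_div_cancel hl0.ne' hlt.ne,
      ← ENNReal.ofReal_rpow_of_nonneg (mul_nonneg (hfpos y).le (hv.nonneg y)) hp.le,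
      ENNReal.ofReal_mul (hfpos y).le, Real.enorm_of_nonneg (hfpos y).le]
  have hlp : l ^ p ≠ ⊤ := ENNReal.rpow_ne_top_of_nonneg hp.le hlt.ne
  have hgp : ∫⁻ y in Metric.ball 0 ‖x‖, ENNReal.ofReal ((f y * v y) ^ p) ≠ ⊤ := by
    simp only [hgh]
    rw [lintegral_const_mul' _ _ hlp]
    exact ENNReal.mul_ne_top hlp
      (((setLIntegral_le_lintegral _ _).trans hmass).trans_lt ENNReal.one_lt_top).ne
  have hv1 : AEMeasurable (fun y => 1 / v y) volume := hv.aemeasurable.const_div 1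
  have key := geomMean_le_mul_rpow (s := s) (g := fun y => f y * v y) hn hp hx hf
    (hf.mul hv.aemeasurable) hv1
    (hv.ae_pos.mono fun y hy => mul_pos (hfpos y) hy)
    (hv.ae_pos.mono fun y hy => by
      rw [← Real.log_mul (mul_pos (hfpos y) hy).ne' (one_div_pos.2 hy).ne']
      field_simp) hgp hGx
  simp only [hgh, mul_assoc] at key
  rw [lintegral_const_mul' _ _ hlp] at key
  set I := ∫⁻ y in Metric.ball 0 ‖x‖, h y *
    volume (Metric.ball (0 : EuclideanSpace ℝ (Fin n)) ‖y‖) ^ (s - 1) with hI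
  have hR : ∫⁻ y, h y * ((if ‖y‖ < ‖x‖ then
      volume (Metric.ball (0 : EuclideanSpace ℝ (Fin n)) ‖y‖) ^ ((s - 1) / p) *
        hardyWeight s p v w x / c else 0) ^ p) = I * (hardyWeight s p v w x / c) ^ p := by
    rw [hI, ← lintegral_mul_const' _ _
      (ENNReal.rpow_ne_top_of_nonneg hp.le (ENNReal.div_ne_top hG hc0.ne')),
      ← lintegral_indicator Metric.isOpen_ball.measurableSet]
    refine lintegral_congr fun y => ?_
    by_cases hy : ‖y‖ < ‖x‖
    · rw [if_pos hy, Set.indicator_of_mem (by simpa using hy), mul_div_assoc,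
        ENNReal.mul_rpow_of_nonneg _ _ hp.le, ← ENNReal.rpow_mul, div_mul_cancel₀ _ hp.ne',
        mul_assoc]
    · rw [if_neg hy, Set.indicator_of_notMem (by simpa using hy), ENNReal.zero_rpow_of_pos hp,
        mul_zero]
  rw [hR, ENNReal.mul_rpow_of_nonneg _ _ (by positivity), ← ENNReal.rpow_mul,
    mul_one_div_cancel hp.ne', ENNReal.rpow_one]
  have hE : ENNReal.ofReal (Real.exp (s - 1)) ^ (1 / p) =
      ENNReal.ofReal (Real.exp ((s - 1) / p)) := by
    rw [ENNReal.ofReal_rpow_of_pos (Real.exp_pos _), ← Real.exp_mul, mul_one_div]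
  have hVs : (V ^ s)⁻¹ ^ (1 / p) = (V ^ (s / p))⁻¹ := by
    rw [← ENNReal.inv_rpow, ← ENNReal.rpow_mul, ENNReal.inv_rpow, mul_one_div]
  have hE0 : ENNReal.ofReal (Real.exp ((s - 1) / p)) ≠ 0 :=
    (ENNReal.ofReal_pos.2 (Real.exp_pos _)).ne'
  have hEt : ENNReal.ofReal (Real.exp ((s - 1) / p)) ≠ ⊤ := ENNReal.ofReal_ne_top
  rw [div_eq_mul_inv, ENNReal.mul_rpow_of_nonneg _ _ (by positivity),
    ENNReal.mul_rpow_of_nonneg _ _ (by positivity), ENNReal.mul_rpow_of_nonneg _ _ (by positivity),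
    hE, hVs, ← ENNReal.rpow_mul, mul_one_div_cancel hp.ne', ENNReal.rpow_one] at key
  rw [hardyWeight, ← hVdef]
  revert key hE0 hEt
  generalize ENNReal.ofReal (Real.exp ((s - 1) / p)) = E
  intro key hE0 hEt
  calc geomMean f x * ENNReal.ofReal (w x) / (E * c * l)
      ≤ (geomMean (fun y => 1 / v y) x * (E * (V ^ (s / p))⁻¹ * (l * I ^ (1 / p)))) *
          ENNReal.ofReal (w x) / (E * c * l) := by gcongr
    _ = (E * E⁻¹) * (l * l⁻¹) * (I ^ (1 / p) * (ENNReal.ofReal (w x) / V ^ (s / p) *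
          geomMean (fun y => 1 / v y) x / c)) := by
        simp only [div_eq_mul_inv]
        rw [ENNReal.mul_inv (Or.inr hlt.ne) (Or.inr hl0.ne'),
          ENNReal.mul_inv (Or.inl hE0) (Or.inl hEt)]
        ring
    _ = _ := by
        rw [ENNReal.mul_inv_cancel hE0 hEt, ENNReal.mul_inv_cancel hl0.ne' hlt.ne, one_mul, one_mul]

theorem geomMeanInequality_of_condD_lt (hn : 0 < n) (hp : 0 < p) (hq : AEMeasurable q volume)
    (hpq : ∀ᵐ x ∂(volume : Measure (EuclideanSpace ℝ (Fin n))), p ≤ q x)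
    (hv : IsWeight v) (hw : IsWeight w) (hc : condD s p q v w < c) (hct : c < ⊤) :
    GeomMeanInequality p q v w (ENNReal.ofReal (Real.exp ((s - 1) / p)) * c) := by
  intro f hf hfpos
  have hpos : ∀ᵐ x ∂(volume : Measure (EuclideanSpace ℝ (Fin n))), 0 < q x :=
    hpq.mono fun x hx => hp.trans_le hx
  have hc0 : 0 < c := pos_of_gt hc
  have hE0 : 0 < ENNReal.ofReal (Real.exp ((s - 1) / p)) := ENNReal.ofReal_pos.2 (Real.exp_pos _)
  have hEc0 := ENNReal.mul_pos hE0.ne' hc0.ne'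
  have hEct := ENNReal.mul_lt_top (ENNReal.ofReal_lt_top (r := Real.exp ((s - 1) / p))) hct
  conv_rhs => rw [luxNorm, sInf_eq_iInf', ENNReal.mul_iInf_of_ne hEc0.ne' hEct.ne]
  -- It suffices that each scale $l$ admissible for $f$ makes $e^{(s-1)/p}c\,l$ admissible for $Gf$.
  refine le_iInf fun ⟨l, hl0, hlt, hmass⟩ => ?_
  rw [setLIntegral_univ] at hmass
  refine sInf_le ⟨ENNReal.mul_pos hEc0.ne' hl0.ne', ENNReal.mul_lt_top hEct hlt, ?_⟩
  rw [setLIntegral_univ]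
  have hWm := aemeasurable_hardyWeight (s := s) (p := p) (v := v) hn hw.aemeasurable
  have hhm : AEMeasurable (fun y => (‖f y‖ₑ * ENNReal.ofReal (v y) / l) ^ p) volume :=
    ((hf.enorm.mul hv.aemeasurable.ennreal_ofReal).div_const l).pow_const p
  have hVm : Measurable fun y : EuclideanSpace ℝ (Fin n) =>
      volume (Metric.ball (0 : EuclideanSpace ℝ (Fin n)) ‖y‖) ^ ((s - 1) / p) :=
    measurable_volume_ball_norm.pow_const _
  set K : EuclideanSpace ℝ (Fin n) → EuclideanSpace ℝ (Fin n) → ℝ≥0∞ := fun x y =>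
    if ‖y‖ < ‖x‖ then volume (Metric.ball (0 : EuclideanSpace ℝ (Fin n)) ‖y‖) ^
      ((s - 1) / p) * hardyWeight s p v w x / c else 0 with hK
  have hKm : ∀ x, Measurable (K x) := fun x =>
    Measurable.ite (measurableSet_lt measurable_norm measurable_const)
      ((hVm.mul_const _).div_const c) measurable_const
  calc ∫⁻ x, (geomMean f x * ENNReal.ofReal (w x) /
        (ENNReal.ofReal (Real.exp ((s - 1) / p)) * c * l)) ^ q x
      ≤ ∫⁻ x, ∫⁻ y, (‖f y‖ₑ * ENNReal.ofReal (v y) / l) ^ p * K x y ^ q x := by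
        refine lintegral_mono_ae ?_
        filter_upwards [hpq, ae_ne_zero_of_pos hn, hw.ae_pos,
          ae_hardyWeight_ne_top hn hq hw.aemeasurable hpos hc hct] with x hqx hx hwx hG
        have h1 := geomMean_mul_div_le hn hp hv hf hfpos hl0 hlt hmass hx hwx hG hc0
        -- With $x$ frozen, $q(x)/p\ge1$ is a constant exponent; this is where $p\le q$ is
        -- essential.
        have h2 := rpow_lintegral_mul_le hhm ((hKm x).pow_const p).aemeasurable hmass
          ((one_le_div hp).2 hqx)
        refine (ENNReal.rpow_le_rpow h1 (hp.le.trans hqx)).trans ?_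
        rw [← ENNReal.rpow_mul, one_div_mul_eq_div]
        refine h2.trans (le_of_eq ?_)
        simp only [← ENNReal.rpow_mul, mul_div_cancel₀ _ hp.ne']
    _ = ∫⁻ y, ∫⁻ x, (‖f y‖ₑ * ENNReal.ofReal (v y) / l) ^ p * K x y ^ q x := by
        refine lintegral_lintegral_swap ?_
        refine hhm.comp_snd.mul (AEMeasurable.pow ?_ hq.comp_fst)
        refine AEMeasurable.congr (((hVm.aemeasurable.comp_snd.mul hWm.comp_fst).div_const
          c).indicator (measurableSet_lt measurable_snd.norm measurable_fst.norm)) ?_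
        exact Filter.Eventually.of_forall fun z => Set.indicator_apply _ _ _
    -- For fixed $y\ne0$ the kernel lives on $|x|>|y|$, so the inner integral is the condition at
    -- $t=|y|$.
    _ ≤ ∫⁻ y, (‖f y‖ₑ * ENNReal.ofReal (v y) / l) ^ p := by
        refine lintegral_mono_ae ?_
        filter_upwards [ae_ne_zero_of_pos hn] with y hy
        rw [lintegral_const_mul' _ _ (ENNReal.rpow_ne_top_of_nonneg hp.le (ENNReal.div_ne_top
          (ENNReal.mul_ne_top enorm_ne_top ENNReal.ofReal_ne_top) hl0.ne'))]
        refine mul_le_of_le_one_right' (le_trans (le_of_eq ?_)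
          (setLIntegral_hardyWeight_le_one hpos hc (norm_pos_iff.2 hy)))
        rw [← lintegral_indicator (measurableSet_lt measurable_const measurable_norm)]
        refine lintegral_congr_ae ?_
        filter_upwards [hpos] with x hqx
        by_cases hxy : ‖y‖ < ‖x‖
        · simp only [hK]
          rw [if_pos hxy, Set.indicator_of_mem (by exact hxy)]
        · simp only [hK]
          rw [if_neg hxy, Set.indicator_of_notMem (by exact hxy), ENNReal.zero_rpow_of_pos hqx]
    _ ≤ 1 := hmass

end HardyBound

/-! ### Necessity: extremal test functions -/

section LowerBound

/-- The logarithm of the extremal profile, equal to `T⁻¹` on `(0,T]` and to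
`e⁻ˢ Tˢ⁻¹ u⁻ˢ` beyond `T`. -/
noncomputable def logProfile (s T u : ℝ) : ℝ :=
  if u ≤ T then -Real.log T else -s + (s - 1) * Real.log T - s * Real.log u

theorem measurable_logProfile (s T : ℝ) : Measurable (logProfile s T) :=
  Measurable.ite measurableSet_Iic measurable_const
    ((measurable_const.sub (Real.measurable_log.const_mul s)))

theorem intervalIntegrable_logProfile_left (s : ℝ) {T : ℝ} (hT : 0 < T) :
    IntervalIntegrable (logProfile s T) volume 0 T := by
  refine (intervalIntegrable_const (c := -Real.log T)).congr ?_
  intro u hu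
  rw [Set.uIoc_of_le hT.le] at hu
  exact (if_pos hu.2).symm

theorem intervalIntegrable_logProfile_right (s : ℝ) {T U : ℝ} (hTU : T ≤ U) :
    IntervalIntegrable (logProfile s T) volume T U := by
  refine ((intervalIntegrable_const (c := -s + (s - 1) * Real.log T)).sub
    (intervalIntegral.intervalIntegrable_log'.const_mul s)).congr ?_
  intro u hu
  rw [Set.uIoc_of_le hTU] at hu
  exact (if_neg hu.1.not_ge).symm

theorem integrableOn_logProfile (s : ℝ) {T U : ℝ} (hT : 0 < T) (hTU : T ≤ U) :
    IntegrableOn (logProfile s T) (Set.Ioo 0 U) :=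
  (intervalIntegrable_iff_integrableOn_Ioo_of_le (hT.le.trans hTU)).1
    ((intervalIntegrable_logProfile_left s hT).trans (intervalIntegrable_logProfile_right s hTU))

/-- The constant $-s$ in the outer piece cancels the linear terms from integrating $\ln u$, and the
$T\ln T$ terms cancel too. Hence the mean is exactly the logarithm of $T^{s-1}U^{-s}$, with no stray
constant. -/
theorem integral_logProfile (s : ℝ) {T U : ℝ} (hT : 0 < T) (hTU : T ≤ U) :
    ∫ u in 0..U, logProfile s T u = U * ((s - 1) * Real.log T - s * Real.log U) := by
  rw [← intervalIntegral.integral_add_adjacent_intervals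
    (intervalIntegrable_logProfile_left s hT) (intervalIntegrable_logProfile_right s hTU)]
  have h1 : ∫ u in 0..T, logProfile s T u = ∫ _ in 0..T, -Real.log T := by
    refine intervalIntegral.integral_congr_ae (ae_of_all _ fun u hu => ?_)
    rw [Set.uIoc_of_le hT.le] at hu
    exact if_pos hu.2
  have h2 : ∫ u in T..U, logProfile s T u =
      ∫ u in T..U, (-s + (s - 1) * Real.log T - s * Real.log u) := by
    refine intervalIntegral.integral_congr_ae (ae_of_all _ fun u hu => ?_)
    rw [Set.uIoc_of_le hTU] at hu
    exact if_neg hu.1.not_ge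
  rw [h1, h2, intervalIntegral.integral_sub intervalIntegrable_const
      (intervalIntegral.intervalIntegrable_log'.const_mul s), intervalIntegral.integral_const,
    intervalIntegral.integral_const, intervalIntegral.integral_const_mul, integral_log,
    smul_eq_mul, smul_eq_mul]
  ring

/-- The inner piece has mass $1$ and the tail $e^{-s}/(s-1)$, both independent of $T$, so the norms
of the test functions are bounded uniformly in $t$. -/
theorem lintegral_exp_logProfile {s T : ℝ} (hs : 1 < s) (hT : 0 < T) :
    ∫⁻ u in Set.Ioi 0, ENNReal.ofReal (Real.exp (logProfile s T u)) =
      ENNReal.ofReal (Real.exp (-s) * (Real.exp s + 1 / (s - 1))) := by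
  have hs' : 0 < s - 1 := sub_pos.2 hs
  rw [← Set.Ioc_union_Ioi_eq_Ioi hT.le, lintegral_union measurableSet_Ioi
    (Set.Ioc_disjoint_Ioi le_rfl)]
  have h1 : ∫⁻ u in Set.Ioc 0 T, ENNReal.ofReal (Real.exp (logProfile s T u)) =
      ENNReal.ofReal 1 := by
    rw [setLIntegral_congr_fun (g := fun _ => ENNReal.ofReal T⁻¹) measurableSet_Ioc
        fun u hu => ?_, setLIntegral_const,
      Real.volume_Ioc, ← ENNReal.ofReal_mul (by positivity), sub_zero, inv_mul_cancel₀ hT.ne']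
    simp only [logProfile]
    rw [if_pos hu.2, Real.exp_neg, Real.exp_log hT]
  have h2 : ∫⁻ u in Set.Ioi T, ENNReal.ofReal (Real.exp (logProfile s T u)) =
      ENNReal.ofReal (Real.exp (-s) / (s - 1)) := by
    rw [setLIntegral_congr_fun (g := fun u => ENNReal.ofReal
        (Real.exp (-s) * T ^ (s - 1) * u ^ (-s))) measurableSet_Ioi fun u hu => ?_,
      ← ofReal_integral_eq_lintegral_ofReal
        ((integrableOn_Ioi_rpow_of_lt (by linarith) hT).const_mul _), integral_const_mul,
      integral_Ioi_rpow_of_lt (by linarith) hT]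
    · congr 1
      have : T ^ (s - 1) * T ^ (-s + 1) = 1 := by
        rw [← Real.rpow_add hT]
        simp
      have h3 : -s + 1 ≠ 0 := by linarith
      have h4 : s - 1 ≠ 0 := hs'.ne'
      rw [mul_assoc, mul_div_assoc', mul_neg, this]
      grind
    · refine (ae_restrict_iff' measurableSet_Ioi).2 (ae_of_all _ fun u hu => ?_)
      have : 0 < u := hT.trans hu
      simp only [Pi.zero_apply]
      positivity
    · have hu' : T < u := hu
      have hu0 : 0 < u := hT.trans hu
      simp only [logProfile]
      rw [if_neg hu'.not_ge, Real.rpow_def_of_pos hT, Real.rpow_def_of_pos hu0, ← Real.exp_add,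
        ← Real.exp_add]
      ring_nf
  rw [h1, h2, ← ENNReal.ofReal_add zero_le_one (by positivity)]
  congr 1
  rw [mul_add, ← Real.exp_add]
  simp [div_eq_mul_inv]

variable {n : ℕ} {p s : ℝ} {q v w : EuclideanSpace ℝ (Fin n) → ℝ}

/-- The extremal function associated with the radius `t`. -/
noncomputable def testFunction (s p t : ℝ) (v : EuclideanSpace ℝ (Fin n) → ℝ)
    (y : EuclideanSpace ℝ (Fin n)) : ℝ :=
  if 0 < v y then Real.exp (logProfile s (ballVol n t) (ballVol n ‖y‖) / p) / v y else 1

/-- The value $1$ where $v$ vanishes, a null set, gives positivity at every point, as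
`GeomMeanInequality` requires. -/
theorem testFunction_pos (s p t : ℝ) (v : EuclideanSpace ℝ (Fin n) → ℝ)
    (y : EuclideanSpace ℝ (Fin n)) : 0 < testFunction s p t v y := by
  rw [testFunction]
  split_ifs <;> positivity

theorem measurable_logProfile_ballVol (s t : ℝ) :
    Measurable fun y : EuclideanSpace ℝ (Fin n) =>
      logProfile s (ballVol n t) (ballVol n ‖y‖) :=
  (measurable_logProfile _ _).comp measurable_ballVol_norm

theorem aemeasurable_testFunction (hv : IsWeight v) (s p t : ℝ) :
    AEMeasurable (testFunction s p t v) volume := by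
  have h : AEMeasurable (fun y : EuclideanSpace ℝ (Fin n) =>
      Real.exp (logProfile s (ballVol n t) (ballVol n ‖y‖) / p) / v y) volume :=
    (Real.measurable_exp.comp ((measurable_logProfile_ballVol s t).div_const
      p)).aemeasurable.div hv.aemeasurable
  exact h.congr (hv.ae_pos.mono fun y hy => (if_pos hy).symm)

theorem lintegral_testFunction (hn : 0 < n) (hp : 0 < p) (hs : 1 < s) (hv : IsWeight v) {t : ℝ}
    (ht : 0 < t) :
    ∫⁻ y, (‖testFunction s p t v y‖ₑ * ENNReal.ofReal (v y)) ^ p =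
      ENNReal.ofReal (Real.exp (-s) * (Real.exp s + 1 / (s - 1))) := by
  have hm : Measurable fun u => ENNReal.ofReal (Real.exp (logProfile s (ballVol n t) u)) :=
    (Real.measurable_exp.comp (measurable_logProfile _ _)).ennreal_ofReal
  rw [← lintegral_exp_logProfile hs (ballVol_pos (n := n) ht), ← map_ballVol_norm hn,
    lintegral_map hm measurable_ballVol_norm]
  refine lintegral_congr_ae (hv.ae_pos.mono fun y hy => ?_)
  simp only
  rw [Real.enorm_of_nonneg (testFunction_pos s p t v y).le,
    ← ENNReal.ofReal_mul (testFunction_pos s p t v y).le, testFunction, if_pos hy,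
    div_mul_cancel₀ _ hy.ne', ENNReal.ofReal_rpow_of_pos (Real.exp_pos _), ← Real.exp_mul,
    div_mul_cancel₀ _ hp.ne']

theorem luxNorm_testFunction_le (hn : 0 < n) (hp : 0 < p) (hs : 1 < s) (hv : IsWeight v) {t : ℝ}
    (ht : 0 < t) :
    luxNorm (fun _ => p) v Set.univ (fun y => ‖testFunction s p t v y‖ₑ) ≤
      ENNReal.ofReal ((Real.exp (-s) * (Real.exp s + 1 / (s - 1))) ^ (1 / p)) := by
  have hs' : 0 < s - 1 := sub_pos.2 hs
  have hM : 0 < Real.exp (-s) * (Real.exp s + 1 / (s - 1)) := by positivity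
  have hMp : ENNReal.ofReal ((Real.exp (-s) * (Real.exp s + 1 / (s - 1))) ^ (1 / p)) ^ p =
      ENNReal.ofReal (Real.exp (-s) * (Real.exp s + 1 / (s - 1))) := by
    rw [ENNReal.ofReal_rpow_of_nonneg (by positivity) hp.le, ← Real.rpow_mul hM.le,
      one_div_mul_cancel hp.ne', Real.rpow_one]
  refine sInf_le ⟨ENNReal.ofReal_pos.2 (by positivity), ENNReal.ofReal_lt_top, ?_⟩
  rw [setLIntegral_univ]
  simp only [div_eq_mul_inv _ (ENNReal.ofReal _), ENNReal.mul_rpow_of_nonneg _ _⁻¹ hp.le,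
    ENNReal.inv_rpow, hMp]
  rw [lintegral_mul_const' _ _ (ENNReal.inv_ne_top.2 (ENNReal.ofReal_pos.2 hM).ne'),
    lintegral_testFunction hn hp hs hv ht,
    ENNReal.mul_inv_cancel (ENNReal.ofReal_pos.2 hM).ne' ENNReal.ofReal_ne_top]

theorem geomMean_testFunction (hn : 0 < n) (hv : IsWeight v) {t : ℝ}
    (ht : 0 < t) {x : EuclideanSpace ℝ (Fin n)} (hx : t < ‖x‖) :
    geomMean (testFunction s p t v) x =
      volume (Metric.ball (0 : EuclideanSpace ℝ (Fin n)) t) ^ ((s - 1) / p) /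
        volume (Metric.ball (0 : EuclideanSpace ℝ (Fin n)) ‖x‖) ^ (s / p) *
          geomMean (fun y => 1 / v y) x := by
  have hx0 : 0 < ‖x‖ := ht.trans hx
  have hT : 0 < ballVol n t := ballVol_pos ht
  have hU : 0 < ballVol n ‖x‖ := ballVol_pos hx0
  have hTU := (ballVol_lt_ballVol hn ht.le hx).le
  have hi := integrableOn_ball_comp_ballVol hn (norm_nonneg x) (integrableOn_logProfile s hT hTU)
  have hlog : ∀ y : EuclideanSpace ℝ (Fin n),
      Real.log (Real.exp (logProfile s (ballVol n t) (ballVol n ‖y‖) / p)) =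
        logProfile s (ballVol n t) (ballVol n ‖y‖) / p := fun y => Real.log_exp _
  have hmul := geomMean_eq_mul (f := testFunction s p t v) (norm_pos_iff.1 hx0)
    (g := fun y => Real.exp (logProfile s (ballVol n t) (ballVol n ‖y‖) / p))
    (u := fun y => 1 / v y) (by simpa only [hlog, IntegrableOn] using hi.div_const p)
    (hv.aemeasurable.const_div 1)
    (hv.ae_pos.mono fun y hy => by
      rw [testFunction, if_pos hy, ← Real.log_mul (Real.exp_pos _).ne' (one_div_pos.2 hy).ne',
        mul_one_div])
  rw [hmul]
  simp only [hlog]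
  rw [integral_div, setIntegral_ball_comp_ballVol hn (norm_nonneg x)
      (integrableOn_logProfile s hT hTU), integral_logProfile s hT hTU,
    ← ofReal_ballVol, ← ofReal_ballVol, ENNReal.ofReal_rpow_of_pos hT,
    ENNReal.ofReal_rpow_of_pos hU, ← ENNReal.ofReal_div_of_pos (by positivity),
    Real.rpow_def_of_pos hT, Real.rpow_def_of_pos hU, ← Real.exp_sub]
  congr 3
  field_simp

/-- On $|x|>t$ the two integrands agree after rescaling $c$ to $c/k$; discarding $|x|\le t$ only
lowers the modular. -/
theorem mul_luxNorm_hardyWeight_le (hn : 0 < n) (hv : IsWeight v) {t : ℝ} (ht : 0 < t) :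
    volume (Metric.ball (0 : EuclideanSpace ℝ (Fin n)) t) ^ ((s - 1) / p) *
        luxNorm q (fun _ => 1) {x | t < ‖x‖} (hardyWeight s p v w) ≤
      luxNorm q w Set.univ (geomMean (testFunction s p t v)) := by
  have hV0 : 0 < volume (Metric.ball (0 : EuclideanSpace ℝ (Fin n)) t) :=
    Metric.measure_ball_pos _ _ ht
  have hVt : volume (Metric.ball (0 : EuclideanSpace ℝ (Fin n)) t) ≠ ⊤ := measure_ball_lt_top.ne
  have hk0 := (ENNReal.rpow_pos (p := (s - 1) / p) hV0 hVt).ne'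
  have hkt := ENNReal.rpow_ne_top_of_ne_zero (y := (s - 1) / p) hV0.ne' hVt
  have hG := fun x hx => geomMean_testFunction (s := s) (p := p) (x := x) hn hv ht hx
  revert hk0 hkt hG
  generalize volume (Metric.ball (0 : EuclideanSpace ℝ (Fin n)) t) ^ ((s - 1) / p) = k
  intro hk0 hkt hG
  refine le_sInf fun c ⟨hc0, hct, hmod⟩ => ?_
  rw [mul_comm, ← ENNReal.le_div_iff_mul_le (Or.inl hk0) (Or.inl hkt)]
  refine sInf_le ⟨ENNReal.div_pos hc0.ne' hkt, ENNReal.div_lt_top hct.ne hk0, ?_⟩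
  refine le_trans (le_of_eq ?_) ((lintegral_mono_set (Set.subset_univ {x | t < ‖x‖})).trans hmod)
  refine setLIntegral_congr_fun (measurableSet_lt measurable_const measurable_norm) fun x hx => ?_
  simp only
  rw [hG x hx, hardyWeight, ENNReal.ofReal_one, mul_one]
  congr 1
  rw [div_eq_mul_inv _ (c / k), ENNReal.inv_div (Or.inl hkt) (Or.inl hk0)]
  simp only [div_eq_mul_inv]
  ring

theorem mul_condD_le (hn : 0 < n) (hp : 0 < p) (hs : 1 < s) (hv : IsWeight v) {C : ℝ≥0∞}
    (hC : GeomMeanInequality p q v w C) :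
    ENNReal.ofReal (Real.exp (s / p) / (Real.exp s + 1 / (s - 1)) ^ (1 / p)) *
      condD s p q v w ≤ C := by
  have hs' : 0 < s - 1 := sub_pos.2 hs
  have hD : condD s p q v w ≤
      C * ENNReal.ofReal ((Real.exp (-s) * (Real.exp s + 1 / (s - 1))) ^ (1 / p)) :=
    iSup₂_le fun t ht => (mul_luxNorm_hardyWeight_le hn hv ht).trans
      ((hC _ (aemeasurable_testFunction hv s p t) (testFunction_pos s p t v)).trans
        (mul_le_mul_right (luxNorm_testFunction_le hn hp hs hv ht) C))
  refine (mul_le_mul_right hD _).trans (le_of_eq ?_)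
  rw [mul_left_comm, ← ENNReal.ofReal_mul (by positivity)]
  have : Real.exp (s / p) / (Real.exp s + 1 / (s - 1)) ^ (1 / p) *
      (Real.exp (-s) * (Real.exp s + 1 / (s - 1))) ^ (1 / p) = 1 := by
    have hA : 0 < (Real.exp s + 1 / (s - 1)) ^ (1 / p) := by positivity
    rw [Real.mul_rpow (Real.exp_nonneg _) (by positivity), ← Real.exp_mul, ← mul_assoc,
      div_mul_eq_mul_div, div_mul_cancel₀ _ hA.ne', ← Real.exp_add]
    simp [div_eq_mul_inv]
  rw [this, ENNReal.ofReal_one, mul_one]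

theorem condD_lt_top (hn : 0 < n) (hp : 0 < p) (hs : 1 < s) (hv : IsWeight v) {C : ℝ≥0∞}
    (hCt : C < ⊤) (hC : GeomMeanInequality p q v w C) : condD s p q v w < ⊤ := by
  have hs' : 0 < s - 1 := sub_pos.2 hs
  have h := mul_condD_le hn hp hs hv hC
  by_contra htop
  rw [not_lt_top_iff.1 htop, ENNReal.mul_top (ENNReal.ofReal_pos.2 (by positivity)).ne'] at h
  exact hCt.not_ge h

end LowerBound

/-! ### Best constant and the exponent factor -/

section BestConstant

variable {n : ℕ} {p s : ℝ} {q v w : EuclideanSpace ℝ (Fin n) → ℝ}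

theorem bestConst_le_exp_mul_condD (hn : 0 < n) (hp : 0 < p) (hq : AEMeasurable q volume)
    (hpq : ∀ᵐ x ∂(volume : Measure (EuclideanSpace ℝ (Fin n))), p ≤ q x)
    (hv : IsWeight v) (hw : IsWeight w) :
    bestConst p q v w ≤ ENNReal.ofReal (Real.exp ((s - 1) / p)) * condD s p q v w := by
  have hE0 : ENNReal.ofReal (Real.exp ((s - 1) / p)) ≠ 0 :=
    (ENNReal.ofReal_pos.2 (Real.exp_pos _)).ne'
  rw [mul_comm, ← ENNReal.div_le_iff_le_mul (Or.inl hE0) (Or.inl ENNReal.ofReal_ne_top)]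
  -- The inequality is available only for $c$ strictly above $D$, so $D$ itself is reached by
  -- density.
  refine le_of_forall_gt_imp_ge_of_dense fun c hc => ?_
  rcases eq_or_ne c ⊤ with rfl | hct
  · exact le_top
  rw [ENNReal.div_le_iff_le_mul (Or.inl hE0) (Or.inl ENNReal.ofReal_ne_top), mul_comm]
  exact sInf_le ⟨ENNReal.mul_pos hE0 (pos_of_gt hc).ne',
    ENNReal.mul_lt_top ENNReal.ofReal_lt_top hct.lt_top,
    geomMeanInequality_of_condD_lt hn hp hq hpq hv hw hc hct.lt_top⟩

theorem exists_geomMeanInequality_of_condD_lt_top (hn : 0 < n) (hp : 0 < p)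
    (hq : AEMeasurable q volume)
    (hpq : ∀ᵐ x ∂(volume : Measure (EuclideanSpace ℝ (Fin n))), p ≤ q x)
    (hv : IsWeight v) (hw : IsWeight w) (hD : condD s p q v w < ⊤) :
    ∃ C : ℝ≥0∞, 0 < C ∧ C < ⊤ ∧ GeomMeanInequality p q v w C := by
  have h := (bestConst_le_exp_mul_condD hn hp hq hpq hv hw).trans_lt
    (ENNReal.mul_lt_top (ENNReal.ofReal_lt_top (r := Real.exp ((s - 1) / p))) hD)
  obtain ⟨C, hC, -⟩ := sInf_lt_iff.1 h
  exact ⟨C, hC⟩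

/-- The base equals $1+p/\underline q-p/\overline q\ge1$, since $\underline q\le\overline q$. The
bounds on $q$ ensure that the real-valued essential bounds are genuine. -/
theorem one_le_exponent_factor {α : Type*} [MeasurableSpace α] {μ : Measure α} [NeZero μ]
    {q : α → ℝ} {Q : ℝ} (hp : 0 < p) (hpq : ∀ᵐ x ∂μ, p ≤ q x) (hqQ : ∀ᵐ x ∂μ, q x ≤ Q) :
    1 ≤ (p / essInf q μ + (essSup q μ - p) / essSup q μ) ^ (2 / p) := by
  have hbelow : Filter.IsBoundedUnder (· ≥ ·) (ae μ) q := ⟨p, hpq⟩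
  have habove : Filter.IsBoundedUnder (· ≤ ·) (ae μ) q := ⟨Q, hqQ⟩
  have h1 : p ≤ essInf q μ := Filter.le_liminf_of_le habove.isCoboundedUnder_ge hpq
  have h2 : essInf q μ ≤ essSup q μ := Filter.liminf_le_limsup habove hbelow
  have hi : 0 < essInf q μ := hp.trans_le h1
  have hS : 0 < essSup q μ := hi.trans_le h2
  refine Real.one_le_rpow ?_ (by positivity)
  rw [sub_div, div_self hS.ne']
  have : p / essSup q μ ≤ p / essInf q μ := div_le_div_of_nonneg_left hp.le hi h2
  linarith

end BestConstant

theorem theorem3 (n : ℕ) (hn : 0 < n) (p Q : ℝ) (hp : 0 < p)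
    (q v w : EuclideanSpace ℝ (Fin n) → ℝ)
    (hq : AEMeasurable q volume)
    (hpq : ∀ᵐ x ∂(volume : Measure (EuclideanSpace ℝ (Fin n))), p ≤ q x)
    (hqQ : ∀ᵐ x ∂(volume : Measure (EuclideanSpace ℝ (Fin n))), q x ≤ Q)
    (hv : IsWeight v) (hw : IsWeight w) :
    ((∃ C : ℝ≥0∞, 0 < C ∧ C < ⊤ ∧ GeomMeanInequality p q v w C) ↔
      ∃ s : ℝ, 1 < s ∧ condD s p q v w < ⊤) ∧
    (1 < p →
      ((∃ C : ℝ≥0∞, 0 < C ∧ C < ⊤ ∧ GeomMeanInequality p q v w C) ↔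
        ∃ s : ℝ, s ∈ Set.Ioo 1 p ∧ condD s p q v w < ⊤)) ∧
    (⨆ (s : ℝ) (_ : 1 < s),
        ENNReal.ofReal (Real.exp (s / p) / (Real.exp s + 1 / (s - 1)) ^ (1 / p)) *
          condD s p q v w) ≤ bestConst p q v w ∧
    bestConst p q v w ≤
      ENNReal.ofReal
        ((p / essInf q volume + (essSup q volume - p) / essSup q volume) ^ (2 / p)) *
        ⨅ (s : ℝ) (_ : 1 < s), ENNReal.ofReal (Real.exp ((s - 1) / p)) * condD s p q v w := by
  have : Nonempty (Fin n) := ⟨⟨0, hn⟩⟩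
  refine ⟨⟨?_, ?_⟩, fun hp1 => ⟨?_, ?_⟩, ?_, ?_⟩
  · rintro ⟨C, -, hCt, hC⟩
    -- Any $s>1$ would serve as witness.
    exact ⟨2, one_lt_two, condD_lt_top hn hp one_lt_two hv hCt hC⟩
  · rintro ⟨s, -, hD⟩
    exact exists_geomMeanInequality_of_condD_lt_top hn hp hq hpq hv hw hD
  · rintro ⟨C, -, hCt, hC⟩
    obtain ⟨s, hs⟩ := exists_between hp1
    exact ⟨s, hs, condD_lt_top hn hp hs.1 hv hCt hC⟩
  · rintro ⟨s, -, hD⟩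
    exact exists_geomMeanInequality_of_condD_lt_top hn hp hq hpq hv hw hD
  · exact iSup₂_le fun s hs => le_sInf fun C hC => mul_condD_le hn hp hs hv hC.2.2
  · refine (le_iInf₂ fun s _ => bestConst_le_exp_mul_condD (s := s) hn hp hq hpq hv hw).trans
      (le_mul_of_one_le_left' ?_)
    rw [← ENNReal.ofReal_one]
    exact ENNReal.ofReal_le_ofReal (one_le_exponent_factor hp hpq hqQ)
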